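/- Let $d\ge 0$ and $n\ge 1$ be integers, let $\Gamma\subset\mathbb{Z}^d$ be a finite non-empty set with $|\Gamma|=D$, and let $x_1,\dots,x_n$ be independent random variables, each uniformly distributed on $[0,1]^d$. Let $U\in\mathbb{C}^{n\times D}$ be the random Fourier matrix with entries $u_{tk}=e^{2\pi i k\cdot x_t}$, $t=1,\dots,n$, $k\in\Gamma$. For integers $m,k\ge 1$ let $S_2(m,k)$ be the associated Stirling number of the second kind, i.e. the number of partitions of an $m$-element set into exactly $k$ blocks each having at least two elements, and put $$F_m(z)=\sum_{k=1}^{\lfloor m/2\rfloor}S_2(m,k)\,z^k,\qquad G_m(z)=z^{-m}F_m(z).$$ Then for every $\varepsilon>0$ and every integer $m\ge 1$, with probability at least $$1-\varepsilon^{-2m}\,D\,G_{2m}(n/D)$$ we have $$\bigl\Vert n^{-1}U^*U-I\bigr\Vert<\varepsilon$$ and hence also $$1-\varepsilon<\lambda_{\min}(n^{-1}U^*U)\le\lambda_{\max}(n^{-1}U^*U)<1+\varepsilon .$$ Here $\Vert\cdot\Vert$ is the operator norm with respect to the Euclidean norm on $\mathbb{C}^D$, and $\lambda_{\min}$, $\lambda_{\max}$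 denote the smallest and largest eigenvalue of a Hermitian matrix. -/

import Mathlib

open scoped Matrix Matrix.Norms.L2Operator

/-- The associated Stirling number of the second kind `S₂(m, k)`: the number of partitions of an
`m`-element set into exactly `k` blocks, each block having at least two elements. -/
def assocStirling (m k : ℕ) : ℕ :=
  Fintype.card {P : Finpartition (Finset.univ : Finset (Fin m)) //
    P.parts.card = k ∧ ∀ b ∈ P.parts, 2 ≤ b.card}

/-- The polynomial `F_m(z) = ∑_{k=1}^{⌊m/2⌋} S₂(m, k) z^k`. -/
noncomputable def stirlingF (m : ℕ) : Polynomial ℝ :=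
  ∑ k ∈ Finset.Icc 1 (m / 2), Polynomial.C (assocStirling m k : ℝ) * Polynomial.X ^ k

/-- `G_m(z) = z^{-m} F_m(z)`. -/
noncomputable def stirlingG (m : ℕ) (z : ℝ) : ℝ :=
  z ^ (-(m : ℤ)) * (stirlingF m).eval z

/-- The Fourier matrix `u_{tk} = e^{2πi k·x_t}`, `k ∈ Γ`, `t = 1, …, n`. -/
noncomputable def fourierMatrix {d n : ℕ} (Γ : Finset (Fin d → ℤ)) (x : Fin n → Fin d → ℝ) :
    Matrix (Fin n) Γ ℂ :=
  Matrix.of fun t k =>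
    Complex.exp (2 * Real.pi * Complex.I * ∑ i, ((k : Fin d → ℤ) i : ℂ) * (x t i : ℂ))

/-- The sample second moment matrix `n⁻¹ U* U`. -/
noncomputable def sampleMoment {d n : ℕ} (Γ : Finset (Fin d → ℤ)) (x : Fin n → Fin d → ℝ) :
    Matrix Γ Γ ℂ :=
  (n : ℂ)⁻¹ • ((fourierMatrix Γ x)ᴴ * fourierMatrix Γ x)

theorem sampleMoment_isHermitian {d n : ℕ} (Γ : Finset (Fin d → ℤ)) (x : Fin n → Fin d → ℝ) :
    (sampleMoment Γ x).IsHermitian := by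
  simp [sampleMoment, Matrix.IsHermitian, Matrix.conjTranspose_smul, Matrix.conjTranspose_mul]

/-- The minimal eigenvalue of a hermitian matrix. -/
noncomputable def lambdaMin {ι : Type*} [Fintype ι] [DecidableEq ι] [Nonempty ι]
    {A : Matrix ι ι ℂ} (hA : A.IsHermitian) : ℝ :=
  Finset.univ.inf' Finset.univ_nonempty hA.eigenvalues

/-- The maximal eigenvalue of a hermitian matrix. -/
noncomputable def lambdaMax {ι : Type*} [Fintype ι] [DecidableEq ι] [Nonempty ι]
    {A : Matrix ι ι ℂ} (hA : A.IsHermitian) : ℝ :=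
  Finset.univ.sup' Finset.univ_nonempty hA.eigenvalues

/-!
For a Hermitian matrix `A`, the even trace moment `tr A ^ (2m)` dominates `‖A‖ ^ (2m)`, so by
Markov's inequality it suffices to bound the expected trace of `(n⁻¹ U* U - 1) ^ M` for `M = 2m`.
The diagonal of `n⁻¹ U* U - 1` vanishes, so the trace expands over the closed walks of length `M` in
`Γ` without stationary steps and over the ways to label each step by one of the `n` samples. The
samples are independent and every non-trivial character has mean zero, so a term survives the
expectation, and then contributes `n ^ (-M)`, exactly when the increments of the steps with a common
label add up to zero, for every label. No label is then used only once, so the fibres of the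
labelling form a partition of the steps into `k ≤ M / 2` blocks with at least two elements each.
There are `S₂(M, k)` such partitions, at most `n ^ k` labellings for each of them, and at most
`D ^ (M + 1 - k)` walks for each labelling: up to the base point, the walk is determined by its
positions at the steps whose label has occurred before. Hence the expected trace is at most
`D * G_M(n / D)`.
-/

section Hermitian

variable {ι 𝕜 : Type*} [Fintype ι] [DecidableEq ι] [RCLike 𝕜]

theorem trace_pow_eq_sum_eigenvalues_pow {A : Matrix ι ι 𝕜} (hA : A.IsHermitian) (N : ℕ) :
    (A ^ N).trace = ∑ i, (hA.eigenvalues i : 𝕜) ^ N := by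
  conv_lhs => rw [hA.spectral_theorem, ← map_pow, Unitary.conjStarAlgAut_apply,
    Matrix.trace_mul_comm, ← mul_assoc, Unitary.coe_star_mul_self, one_mul, Matrix.diagonal_pow,
    Matrix.trace_diagonal]
  simp only [Pi.pow_apply, Function.comp_apply]

theorem isGreatest_range_abs_eigenvalues_norm [Nonempty ι] {A : Matrix ι ι ℂ}
    (hA : A.IsHermitian) : IsGreatest (Set.range fun i => |hA.eigenvalues i|) ‖A‖ := by
  have h := IsometricContinuousFunctionalCalculus.isGreatest_norm_spectrum (𝕜 := ℝ) A hA
  rwa [hA.spectrum_real_eq_range_eigenvalues, ← Set.range_comp] at h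

theorem norm_pow_le_re_trace_pow [Nonempty ι] {A : Matrix ι ι ℂ} (hA : A.IsHermitian) (m : ℕ) :
    ‖A‖ ^ (2 * m) ≤ (A ^ (2 * m)).trace.re := by
  obtain ⟨i, hi : |hA.eigenvalues i| = ‖A‖⟩ := (isGreatest_range_abs_eigenvalues_norm hA).1
  have htrace : (A ^ (2 * m)).trace.re = ∑ j, hA.eigenvalues j ^ (2 * m) := by
    rw [trace_pow_eq_sum_eigenvalues_pow hA]
    norm_cast
  rw [htrace, ← hi, (even_two_mul m).pow_abs]
  exact Finset.single_le_sum (f := fun j => hA.eigenvalues j ^ (2 * m))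
    (fun j _ => (even_two_mul m).pow_nonneg _) (Finset.mem_univ i)

theorem abs_eigenvalues_sub_le_norm {A : Matrix ι ι ℂ} (hA : A.IsHermitian) (c : ℝ) (i : ι) :
    |hA.eigenvalues i - c| ≤ ‖A - algebraMap ℝ _ c‖ := by
  have : Nonempty ι := ⟨i⟩
  refine spectrum.norm_le_norm_of_mem (𝕜 := ℝ) (a := A - algebraMap ℝ _ c) ?_
  rw [← spectrum.sub_singleton_eq]
  exact Set.sub_mem_sub (hA.eigenvalues_mem_spectrum_real i) rfl

variable [Nonempty ι] {A : Matrix ι ι ℂ} (hA : A.IsHermitian)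

theorem lambdaMin_le_lambdaMax : lambdaMin hA ≤ lambdaMax hA :=
  (Finset.inf'_le _ (Finset.mem_univ (Classical.arbitrary ι))).trans
    (Finset.le_sup' _ (Finset.mem_univ _))

variable {c ε : ℝ}

theorem sub_lt_lambdaMin (h : ‖A - algebraMap ℝ _ c‖ < ε) : c - ε < lambdaMin hA := by
  rw [lambdaMin, Finset.lt_inf'_iff]
  intro i _
  linarith [(abs_lt.1 ((abs_eigenvalues_sub_le_norm hA c i).trans_lt h)).1]

theorem lambdaMax_lt_add (h : ‖A - algebraMap ℝ _ c‖ < ε) : lambdaMax hA < c + ε := by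
  rw [lambdaMax, Finset.sup'_lt_iff]
  intro i _
  linarith [(abs_lt.1 ((abs_eigenvalues_sub_le_norm hA c i).trans_lt h)).2]

end Hermitian

section Markov

open MeasureTheory

theorem one_sub_trace_moment_le_measureReal_norm_lt {ι Ω : Type*} [Fintype ι] [DecidableEq ι]
    [Nonempty ι] [MeasurableSpace Ω] {P : Measure Ω} [IsProbabilityMeasure P]
    {A : Ω → Matrix ι ι ℂ} (hA : ∀ ω, (A ω).IsHermitian) {m : ℕ}
    (hint : Integrable (fun ω => (A ω ^ (2 * m)).trace) P) {ε : ℝ} (hε : 0 < ε) :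
    1 - ε ^ (-(2 * m : ℤ)) * (∫ ω, (A ω ^ (2 * m)).trace ∂P).re ≤ P.real {ω | ‖A ω‖ < ε} := by
  set f : Ω → ℝ := fun ω => (A ω ^ (2 * m)).trace.re
  have hnorm (ω : Ω) : ‖A ω‖ ^ (2 * m) ≤ f ω := norm_pow_le_re_trace_pow (hA ω) m
  have hf : Integrable f P := hint.re
  have markov : ε ^ (2 * m) * P.real {ω | ε ^ (2 * m) ≤ f ω} ≤ ∫ ω, f ω ∂P :=
    mul_meas_ge_le_integral_of_nonneg
      (.of_forall fun ω => (pow_nonneg (norm_nonneg _) _).trans (hnorm ω)) hf _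
  have hzpow : ε ^ (-(2 * m : ℤ)) = (ε ^ (2 * m))⁻¹ := by
    rw [zpow_neg]
    norm_cast
  calc 1 - ε ^ (-(2 * m : ℤ)) * (∫ ω, (A ω ^ (2 * m)).trace ∂P).re
      = 1 - (ε ^ (2 * m))⁻¹ * ∫ ω, f ω ∂P := by
        rw [hzpow, show ∫ ω, f ω ∂P = _ from integral_re hint, RCLike.re_eq_complex_re]
    _ ≤ 1 - P.real {ω | ε ^ (2 * m) ≤ f ω} := by
        rw [inv_mul_eq_div]
        gcongr
        exact (le_div_iff₀' (pow_pos hε _)).2 markov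
    _ = P.real {ω | ε ^ (2 * m) ≤ f ω}ᶜ := by
        rw [measureReal_compl₀ (nullMeasurableSet_le aemeasurable_const hf.aemeasurable),
          probReal_univ]
    _ ≤ P.real {ω | ‖A ω‖ < ε} := measureReal_mono fun ω hω =>
        lt_of_pow_lt_pow_left₀ _ hε.le ((hnorm ω).trans_lt (not_le.1 hω))

end Markov

section ClosedWalks

variable {ι R : Type*} [Fintype ι] [DecidableEq ι] [CommSemiring R]

theorem pow_mul_apply_eq_sum_walks (A B : Matrix ι ι R) (N : ℕ) (j k : ι) :
    (A ^ N * B) j k = ∑ p : Fin N → ι,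
      (∏ i : Fin N, A (Fin.cons (α := fun _ => ι) j p i.castSucc) (p i)) *
        B (Fin.cons (α := fun _ => ι) j p (Fin.last N)) k := by
  induction N generalizing j with
  | zero => simp
  | succ N ih =>
    rw [pow_succ', mul_assoc, Matrix.mul_apply, ← (Fin.consEquiv fun _ : Fin (N + 1) => ι).sum_comp,
      Fintype.sum_prod_type]
    refine Finset.sum_congr rfl fun l _ => ?_
    rw [ih, Finset.mul_sum]
    refine Finset.sum_congr rfl fun p _ => ?_
    simp only [Fin.consEquiv_apply, Fin.prod_univ_succ, Fin.castSucc_zero, Fin.cons_zero,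
      Fin.cons_succ, ← Fin.succ_castSucc, ← Fin.succ_last, mul_assoc]

theorem trace_pow_eq_sum_closed_walks (A : Matrix ι ι R) (N : ℕ) [NeZero N] :
    (A ^ N).trace = ∑ p : Fin N → ι, ∏ i, A (p i) (p (i + 1)) := by
  obtain ⟨N, rfl⟩ := Nat.exists_eq_add_one_of_ne_zero (NeZero.ne N)
  rw [← (Fin.consEquiv fun _ : Fin (N + 1) => ι).sum_comp, Fintype.sum_prod_type, Matrix.trace]
  refine Finset.sum_congr rfl fun j _ => ?_
  rw [Matrix.diag_apply, pow_succ, pow_mul_apply_eq_sum_walks]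
  refine Finset.sum_congr rfl fun p _ => ?_
  simp only [Fin.consEquiv_apply, Fin.prod_univ_castSucc, Fin.coeSucc_eq_succ, Fin.cons_succ,
    Fin.last_add_one, Fin.cons_zero]

end ClosedWalks

section FirstOccurrences

open Finset

variable {α τ : Type*} [Fintype α] [LinearOrder α] [DecidableEq τ]

/-- The indices at which the labelling `t` takes a value for the first time. -/
def firstOccurrences (t : α → τ) : Finset α := {i | ∀ j < i, t j ≠ t i}

theorem mem_firstOccurrences {t : α → τ} {i : α} :
    i ∈ firstOccurrences t ↔ ∀ j < i, t j ≠ t i := by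
  simp [firstOccurrences]

theorem injOn_firstOccurrences (t : α → τ) : Set.InjOn t (firstOccurrences t) := by
  intro i hi j hj hij
  rcases lt_trichotomy i j with h | h | h
  · exact absurd hij (mem_firstOccurrences.1 hj i h)
  · exact h
  · exact absurd hij.symm (mem_firstOccurrences.1 hi j h)

theorem image_firstOccurrences (t : α → τ) : (firstOccurrences t).image t = univ.image t := by
  refine (image_subset_image (subset_univ _)).antisymm fun s hs => ?_
  have hne : ({i | t i = s} : Finset α).Nonempty := by
    obtain ⟨i, -, hi⟩ := mem_image.1 hs
    exact ⟨i, by simpa using hi⟩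
  have hmin : t (({i | t i = s} : Finset α).min' hne) = s := (mem_filter.1 (min'_mem _ hne)).2
  refine mem_image.2 ⟨_, mem_firstOccurrences.2 fun j hj hts => ?_, hmin⟩
  exact hj.not_ge (min'_le _ _ (by simpa using hts.trans hmin))

theorem card_firstOccurrences (t : α → τ) : #(firstOccurrences t) = #(univ.image t) := by
  rw [← image_firstOccurrences, card_image_of_injOn (injOn_firstOccurrences t)]

end FirstOccurrences

section BalancedLoops

open Finset

variable {V τ : Type*} [AddCommGroup V] [DecidableEq τ] {M : ℕ} [NeZero M]

/-- A closed loop `r 0, r 1, …, r (M - 1), r 0`, whose step out of `r i` carries the label `t i`, is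
balanced if the increments of the steps with a common label add up to zero. Addition in `Fin M` is
cyclic, so `r (i + 1)` is the successor of `r i` along the loop. -/
def IsBalanced (t : Fin M → τ) (r : Fin M → V) : Prop :=
  ∀ s, ∑ i with t i = s, (r (i + 1) - r i) = 0

theorem IsBalanced.sub {t : Fin M → τ} {r r' : Fin M → V} (h : IsBalanced t r)
    (h' : IsBalanced t r') : IsBalanced t (r - r') := fun s => by
  calc ∑ i with t i = s, ((r - r') (i + 1) - (r - r') i)
      = ∑ i with t i = s, ((r (i + 1) - r i) - (r' (i + 1) - r' i)) :=
        sum_congr rfl fun _ _ => sub_sub_sub_comm _ _ _ _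
    _ = 0 := by rw [sum_sub_distrib, h s, h' s, sub_zero]

theorem fin_add_one_eq_zero_or_lt_add_one (i : Fin M) : i + 1 = 0 ∨ i < i + 1 := by
  obtain ⟨N, rfl⟩ := Nat.exists_eq_add_one_of_ne_zero (NeZero.ne M)
  rcases eq_or_ne i (Fin.last N) with rfl | h
  · exact .inl (Fin.last_add_one N)
  · exact .inr (Fin.lt_add_one_iff.2 (Fin.lt_last_iff_ne_last.2 h))

/- Backward induction along the loop: in the balance equation of the label of a first occurrence
`i`, every other term involves position `0`, a later position, or one where the label repeats. -/
theorem IsBalanced.eq_zero {t : Fin M → τ} {r : Fin M → V} (hr : IsBalanced t r) (h0 : r 0 = 0)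
    (hrep : ∀ i ∉ firstOccurrences t, r i = 0) : r = 0 := by
  funext i
  induction i using WellFoundedGT.induction with | ind i ih =>
  rcases em' (i ∈ firstOccurrences t) with hi | hi
  · exact hrep i hi
  have hle {l : Fin M} (hl : t l = t i) : i ≤ l :=
    not_lt.1 fun hlt => mem_firstOccurrences.1 hi l hlt hl
  have hsucc : ∑ l with t l = t i, r (l + 1) = 0 := sum_eq_zero fun l hl => by
    rcases fin_add_one_eq_zero_or_lt_add_one l with h | h
    · rw [h, h0]
    · exact ih _ ((hle (mem_filter.1 hl).2).trans_lt h)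
  have hself : ∑ l with t l = t i, r l = r i := by
    refine sum_eq_single_of_mem i (by simp) fun l hl hne => hrep l fun hfirst => hne ?_
    exact injOn_firstOccurrences t hfirst hi (mem_filter.1 hl).2
  have hbal := hr (t i)
  rwa [sum_sub_distrib, hsucc, hself, zero_sub, neg_eq_zero] at hbal

open scoped Classical in
theorem card_isBalanced_le (Γ : Finset V) (t : Fin M → τ) :
    #{p : Fin M → Γ | IsBalanced t fun i => (p i : V)} ≤ #Γ ^ (M + 1 - #(univ.image t)) := by
  let free : Finset (Fin M) := insert 0 (firstOccurrences t)ᶜ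
  have hfirst : (0 : Fin M) ∈ firstOccurrences t :=
    mem_firstOccurrences.2 fun j hj => absurd hj (Fin.not_lt_zero j)
  have hfree : #free = M + 1 - #(univ.image t) := by
    rw [card_insert_of_notMem (by simpa using hfirst), card_compl, Fintype.card_fin,
      card_firstOccurrences, ← Nat.sub_add_comm (card_image_le.trans_eq (card_fin M))]
  have hcard : #(univ : Finset (free → Γ)) = #Γ ^ (M + 1 - #(univ.image t)) := by
    rw [card_univ, Fintype.card_fun, Fintype.card_coe, Fintype.card_coe, hfree]
  rw [← hcard]
  refine card_le_card_of_injOn (fun p i => p i) (fun _ _ => mem_coe.2 (mem_univ _)) ?_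
  intro p hp q hq hpq
  have hagree {i : Fin M} (hi : i ∈ free) : (p i : V) - q i = 0 := by
    rw [sub_eq_zero, show p i = q i from congrFun hpq ⟨i, hi⟩]
  have hzero : (fun i => (p i : V)) - (fun i => (q i : V)) = 0 :=
    ((mem_filter.1 hp).2.sub (mem_filter.1 hq).2).eq_zero (hagree (mem_insert_self _ _))
      fun i hi => hagree (mem_insert_of_mem (mem_compl.2 hi))
  exact funext fun i => Subtype.ext (sub_eq_zero.1 (congrFun hzero i))

open scoped Classical in
/-- The balanced loops in `Γ`, for the labelling `t` of their steps, without stationary steps. -/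
noncomputable def balancedLoops (Γ : Finset V) (t : Fin M → τ) : Finset (Fin M → Γ) :=
  {p | (∀ i, p i ≠ p (i + 1)) ∧ IsBalanced t fun i => (p i : V)}

theorem card_balancedLoops_le (Γ : Finset V) (t : Fin M → τ) :
    #(balancedLoops Γ t) ≤ #Γ ^ (M + 1 - #(univ.image t)) := by
  classical
  exact (card_le_card (monotone_filter_right _ fun _ _ h => h.2)).trans (card_isBalanced_le Γ t)

theorem one_lt_card_fibre_of_mem_balancedLoops {Γ : Finset V} {t : Fin M → τ} {p : Fin M → Γ}
    (hp : p ∈ balancedLoops Γ t) (i : Fin M) : 1 < #{j | t j = t i} := by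
  classical
  obtain ⟨hmove, hbal⟩ := (mem_filter.1 hp).2
  have hi : i ∈ ({j | t j = t i} : Finset (Fin M)) := by simp
  refine lt_of_le_of_ne' (card_pos.2 ⟨i, hi⟩) fun h => hmove i ?_
  obtain ⟨j, hj⟩ := card_eq_one.1 h
  obtain rfl : i = j := mem_singleton.1 (hj ▸ hi)
  have hstep := hbal (t i)
  rw [hj, sum_singleton, sub_eq_zero] at hstep
  exact Subtype.ext hstep.symm

end BalancedLoops

section KerPartition

open Finset

variable {α τ : Type*} [Fintype α] [DecidableEq α] [DecidableEq τ]

/-- The partition of the domain of `t` into the nonempty fibres of `t`. -/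
def kerPartition (t : α → τ) : Finpartition (univ : Finset α) :=
  letI : DecidableRel (Setoid.ker t) := fun i j => inferInstanceAs (Decidable (t i = t j))
  Finpartition.ofSetoid (Setoid.ker t)

theorem mem_part_kerPartition {t : α → τ} {i j : α} :
    j ∈ (kerPartition t).part i ↔ t i = t j := by
  rw [kerPartition, Finpartition.mem_part_ofSetoid_iff_rel, Setoid.ker_def]

theorem kerPartition_parts (t : α → τ) :
    (kerPartition t).parts = (univ.image t).image fun s => ({j | t j = s} : Finset α) := by
  ext b
  simp [kerPartition, Finpartition.ofSetoid, Finpartition.ofSetSetoid, eq_comm]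

theorem card_parts_kerPartition (t : α → τ) : #(kerPartition t).parts = #(univ.image t) := by
  rw [kerPartition_parts, card_image_of_injOn]
  intro s hs s' _ h
  obtain ⟨i, -, rfl⟩ := mem_image.1 (mem_coe.1 hs)
  have hi : i ∈ ({j | t j = s'} : Finset α) := h.subset (by simp)
  exact (mem_filter.1 hi).2

theorem card_kerPartition_eq_le [Fintype τ] (P : Finpartition (univ : Finset α)) :
    #{t : α → τ | kerPartition t = P} ≤ Fintype.card τ ^ #P.parts := by
  choose rep hrep using fun b : P.parts => P.nonempty_of_mem_parts b.2
  have hcard : #(univ : Finset (P.parts → τ)) = Fintype.card τ ^ #P.parts := by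
    rw [card_univ, Fintype.card_fun, Fintype.card_coe]
  rw [← hcard]
  refine card_le_card_of_injOn (fun t b => t (rep b)) (fun _ _ => mem_coe.2 (mem_univ _)) ?_
  intro t ht u hu htu
  funext i
  let b : P.parts := ⟨P.part i, P.part_mem.2 (mem_univ i)⟩
  have heq {v : α → τ} (hv : kerPartition v = P) : v i = v (rep b) :=
    mem_part_kerPartition.1 (by rw [hv]; exact hrep b)
  rw [heq (mem_filter.1 ht).2, heq (mem_filter.1 hu).2]
  exact congrFun htu b

end KerPartition

section Stirling

open Finset

theorem card_parts_mem_Icc {α : Type*} [Fintype α] [DecidableEq α] [Nonempty α]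
    {P : Finpartition (univ : Finset α)} (hP : ∀ b ∈ P.parts, 2 ≤ #b) :
    #P.parts ∈ Icc 1 (Fintype.card α / 2) := by
  have hpos : 0 < #P.parts := card_pos.2 (P.parts_nonempty univ_nonempty.ne_empty)
  have htwo : #P.parts • 2 ≤ Fintype.card α :=
    (card_nsmul_le_sum _ _ _ hP).trans_eq P.sum_card_parts
  rw [mem_Icc]
  lia

theorem sum_card_parts_eq_sum_assocStirling {R : Type*} [Semiring R] (M : ℕ) [NeZero M]
    (f : ℕ → R) :
    ∑ P : Finpartition (univ : Finset (Fin M)) with ∀ b ∈ P.parts, 2 ≤ #b, f #P.parts =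
      ∑ k ∈ Icc 1 (M / 2), assocStirling M k * f k := by
  have hmaps : ∀ P ∈ ({P | ∀ b ∈ P.parts, 2 ≤ #b} : Finset (Finpartition (univ : Finset (Fin M)))),
      #P.parts ∈ Icc 1 (M / 2) := fun P hP => by
    simpa using card_parts_mem_Icc (mem_filter.1 hP).2
  rw [← sum_fiberwise_of_maps_to' hmaps]
  refine sum_congr rfl fun k _ => ?_
  rw [sum_const, nsmul_eq_mul, assocStirling, Fintype.card_subtype, filter_filter]
  simp only [and_comm]

variable {V τ : Type*} [AddCommGroup V] [Fintype τ] {M : ℕ} [NeZero M]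

theorem sum_card_balancedLoops_le [DecidableEq τ] (Γ : Finset V) :
    ∑ t : Fin M → τ, #(balancedLoops Γ t) ≤
      ∑ k ∈ Icc 1 (M / 2), assocStirling M k * (Fintype.card τ ^ k * #Γ ^ (M + 1 - k)) := by
  have hthin (P : Finpartition (univ : Finset (Fin M))) (hP : ¬∀ b ∈ P.parts, 2 ≤ #b) :
      ∑ t : Fin M → τ with kerPartition t = P, #(balancedLoops Γ t) = 0 := by
    refine sum_eq_zero fun t ht => card_eq_zero.2 (eq_empty_of_forall_notMem fun p hp => hP ?_)
    rw [← (mem_filter.1 ht).2, kerPartition_parts, image_image, forall_mem_image]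
    exact fun i _ => one_lt_card_fibre_of_mem_balancedLoops hp i
  have hfibre (P : Finpartition (univ : Finset (Fin M))) :
      ∑ t : Fin M → τ with kerPartition t = P, #(balancedLoops Γ t) ≤
        Fintype.card τ ^ #P.parts * #Γ ^ (M + 1 - #P.parts) := by
    refine (sum_le_card_nsmul _ _ (#Γ ^ (M + 1 - #P.parts)) fun t ht => ?_).trans
      (Nat.mul_le_mul_right _ (card_kerPartition_eq_le P))
    rw [← (mem_filter.1 ht).2, card_parts_kerPartition]
    exact card_balancedLoops_le Γ t
  calc ∑ t : Fin M → τ, #(balancedLoops Γ t)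
      = ∑ P, ∑ t : Fin M → τ with kerPartition t = P, #(balancedLoops Γ t) :=
        (sum_fiberwise _ _ _).symm
    _ = ∑ P : Finpartition (univ : Finset (Fin M)) with ∀ b ∈ P.parts, 2 ≤ #b,
          ∑ t : Fin M → τ with kerPartition t = P, #(balancedLoops Γ t) :=
        (sum_filter_of_ne fun P _ => not_imp_comm.1 (hthin P)).symm
    _ ≤ ∑ P : Finpartition (univ : Finset (Fin M)) with ∀ b ∈ P.parts, 2 ≤ #b,
          Fintype.card τ ^ #P.parts * #Γ ^ (M + 1 - #P.parts) := sum_le_sum fun P _ => hfibre P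
    _ = ∑ k ∈ Icc 1 (M / 2), assocStirling M k * (Fintype.card τ ^ k * #Γ ^ (M + 1 - k)) :=
        sum_card_parts_eq_sum_assocStirling M fun k => Fintype.card τ ^ k * #Γ ^ (M + 1 - k)

theorem mul_stirlingG_div (M : ℕ) (a : ℝ) {b : ℝ} (hb : b ≠ 0) :
    b * stirlingG M (a / b) =
      a⁻¹ ^ M * ∑ k ∈ Icc 1 (M / 2), assocStirling M k * (a ^ k * b ^ (M + 1 - k)) := by
  rw [stirlingG, stirlingF, Polynomial.eval_finsetSum, mul_sum, mul_sum, mul_sum]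
  refine sum_congr rfl fun k hk => ?_
  have hpow : b * b ^ M = b ^ k * b ^ (M + 1 - k) := by
    rw [← pow_succ', pow_mul_pow_sub b (by grind)]
  simp only [Polynomial.eval_mul, Polynomial.eval_C, Polynomial.eval_pow, Polynomial.eval_X,
    zpow_neg, zpow_natCast, div_pow, inv_pow, inv_div]
  field_simp
  linear_combination assocStirling M k * a ^ k / a ^ M * hpow

end Stirling

section CharacterMoment

theorem addChar_map_sum {ι V R : Type*} [AddCommMonoid V] [CommMonoid R] (ψ : AddChar V R)
    (s : Finset ι) (v : ι → V) : ψ (∑ i ∈ s, v i) = ∏ i ∈ s, ψ (v i) :=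
  map_prod ψ.toMonoidHom (fun i => Multiplicative.ofAdd (v i)) s

theorem prod_sum_addChar_eq_sum_labellings {ι τ V R : Type*} [Fintype ι] [DecidableEq ι]
    [Fintype τ] [DecidableEq τ] [AddCommMonoid V] [CommSemiring R] (χ : τ → AddChar V R)
    (v : ι → V) : ∏ i, ∑ t, χ t (v i) = ∑ t : ι → τ, ∏ s, χ s (∑ i with t i = s, v i) := by
  rw [Finset.prod_univ_sum, Fintype.piFinset_univ]
  refine Finset.sum_congr rfl fun t _ => ?_
  rw [← Finset.prod_fiberwise Finset.univ t]
  refine Finset.prod_congr rfl fun s _ => ?_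
  rw [addChar_map_sum]
  exact Finset.prod_congr rfl fun i hi => by rw [(Finset.mem_filter.1 hi).2]

variable {V τ : Type*} [AddCommGroup V] [Fintype τ]

/-- The matrix `u_{tk} = χ_t(k)` of the characters `χ_t` of `V` restricted to `Γ`. It generalizes
`fourierMatrix`, where `V` is a lattice. -/
noncomputable def characterMatrix (Γ : Finset V) (χ : τ → AddChar V Circle) : Matrix τ Γ ℂ :=
  Matrix.of fun t k => (χ t k : ℂ)

/-- The sample second moment matrix `n⁻¹ U* U` of the character matrix `U` with `n` rows. It
generalizes `sampleMoment`. -/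
noncomputable def characterMoment (Γ : Finset V) (χ : τ → AddChar V Circle) : Matrix Γ Γ ℂ :=
  (Fintype.card τ : ℂ)⁻¹ • ((characterMatrix Γ χ)ᴴ * characterMatrix Γ χ)

theorem characterMoment_isHermitian (Γ : Finset V) (χ : τ → AddChar V Circle) :
    (characterMoment Γ χ).IsHermitian := by
  refine (Matrix.isHermitian_conjTranspose_mul_self _).smul ?_
  simp [IsSelfAdjoint]

theorem characterMoment_apply (Γ : Finset V) (χ : τ → AddChar V Circle) (j k : Γ) :
    characterMoment Γ χ j k = (Fintype.card τ : ℂ)⁻¹ * ∑ t, (χ t (k - j) : ℂ) := by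
  rw [characterMoment, Matrix.smul_apply, Matrix.mul_apply, smul_eq_mul]
  refine congrArg _ (Finset.sum_congr rfl fun t _ => ?_)
  rw [Matrix.conjTranspose_apply, characterMatrix, Matrix.of_apply, Matrix.of_apply,
    AddChar.map_sub_eq_div, div_eq_inv_mul, Circle.coe_mul, Circle.coe_inv_eq_conj,
    Complex.star_def]

variable [DecidableEq V]

theorem characterMoment_sub_one_apply [Nonempty τ] (Γ : Finset V) (χ : τ → AddChar V Circle)
    (j k : Γ) : (characterMoment Γ χ - 1) j k =
      if j = k then 0 else (Fintype.card τ : ℂ)⁻¹ * ∑ t, (χ t (k - j) : ℂ) := by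
  rw [Matrix.sub_apply, characterMoment_apply]
  split_ifs with h
  · subst h
    simp
  · rw [Matrix.one_apply_ne h, sub_zero]

theorem trace_characterMoment_sub_one_pow [Nonempty τ] [DecidableEq τ] (Γ : Finset V)
    (χ : τ → AddChar V Circle) (M : ℕ) [NeZero M] :
    ((characterMoment Γ χ - 1) ^ M).trace = (Fintype.card τ : ℂ)⁻¹ ^ M *
      ∑ t : Fin M → τ, ∑ p : Fin M → Γ with ∀ i, p i ≠ p (i + 1),
        ∏ s, (χ s (∑ i with t i = s, ((p (i + 1) : V) - p i)) : ℂ) := by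
  have hwalk (p : Fin M → Γ) : ∏ i, (characterMoment Γ χ - 1) (p i) (p (i + 1)) =
      if ∀ i, p i ≠ p (i + 1) then (Fintype.card τ : ℂ)⁻¹ ^ M *
        ∑ t : Fin M → τ, ∏ s, (χ s (∑ i with t i = s, ((p (i + 1) : V) - p i)) : ℂ) else 0 := by
    simp only [characterMoment_sub_one_apply]
    split_ifs with h
    · rw [Finset.prod_congr rfl fun i _ => if_neg (h i), Finset.prod_mul_distrib,
        Finset.prod_const, Finset.card_fin]
      exact congrArg _ (prod_sum_addChar_eq_sum_labellings
        (fun t => Circle.coeHom.compAddChar (χ t)) _)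
    · obtain ⟨i, hi⟩ := not_forall_not.1 h
      exact Finset.prod_eq_zero (Finset.mem_univ i) (if_pos hi)
  simp only [trace_pow_eq_sum_closed_walks, hwalk]
  rw [← Finset.sum_filter, ← Finset.mul_sum, Finset.sum_comm]

end CharacterMoment

section RandomCharacters

open MeasureTheory ProbabilityTheory

variable {V τ Ω : Type*} [AddCommGroup V] [Fintype τ] [MeasurableSpace Ω] {P : Measure Ω}
  {χ : τ → Ω → AddChar V Circle}

theorem integrable_prod_character [IsFiniteMeasure P]
    (hmeas : ∀ t v, AEStronglyMeasurable (fun ω => (χ t ω v : ℂ)) P) (v : τ → V) :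
    Integrable (fun ω => ∏ s, (χ s ω (v s) : ℂ)) P := by
  refine .of_bound (C := 1) ?_ (.of_forall fun ω => ?_)
  · exact Finset.aestronglyMeasurable_fun_prod _ fun s _ => hmeas s (v s)
  · simp only [norm_prod, Circle.norm_coe, Finset.prod_const_one, le_refl]

theorem integral_prod_character [IsProbabilityMeasure P]
    (hmeas : ∀ t v, AEStronglyMeasurable (fun ω => (χ t ω v : ℂ)) P)
    (hindep : iIndepFun (fun t ω v => (χ t ω v : ℂ)) P)
    (hmean : ∀ t v, v ≠ 0 → ∫ ω, (χ t ω v : ℂ) ∂P = 0) (v : τ → V)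
    [Decidable (∀ s, v s = 0)] :
    ∫ ω, ∏ s, (χ s ω (v s) : ℂ) ∂P = if ∀ s, v s = 0 then 1 else 0 := by
  have hval : iIndepFun (fun s ω => (χ s ω (v s) : ℂ)) P :=
    hindep.comp (fun s f => f (v s)) fun s => measurable_pi_apply (v s)
  rw [hval.integral_fun_prod_eq_prod_integral fun s => hmeas s (v s)]
  split_ifs with h
  · simp [h]
  · obtain ⟨s, hs⟩ := not_forall.1 h
    exact Finset.prod_eq_zero (Finset.mem_univ s) (hmean s _ hs)

variable [DecidableEq V] [Nonempty τ]

theorem integrable_trace_characterMoment_sub_one_pow [IsFiniteMeasure P] (Γ : Finset V)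
    (hmeas : ∀ t v, AEStronglyMeasurable (fun ω => (χ t ω v : ℂ)) P) (M : ℕ) [NeZero M] :
    Integrable (fun ω => ((characterMoment Γ (χ · ω) - 1) ^ M).trace) P := by
  classical
  simp only [trace_characterMoment_sub_one_pow]
  exact (integrable_finsetSum _ fun t _ => integrable_finsetSum _ fun p _ =>
    integrable_prod_character hmeas _).const_mul _

theorem integral_trace_characterMoment_sub_one_pow [DecidableEq τ] [IsProbabilityMeasure P]
    (Γ : Finset V) (hmeas : ∀ t v, AEStronglyMeasurable (fun ω => (χ t ω v : ℂ)) P)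
    (hindep : iIndepFun (fun t ω v => (χ t ω v : ℂ)) P)
    (hmean : ∀ t v, v ≠ 0 → ∫ ω, (χ t ω v : ℂ) ∂P = 0) (M : ℕ) [NeZero M] :
    ∫ ω, ((characterMoment Γ (χ · ω) - 1) ^ M).trace ∂P =
      (Fintype.card τ : ℂ)⁻¹ ^ M * ∑ t : Fin M → τ, ((balancedLoops Γ t).card : ℂ) := by
  classical
  simp only [trace_characterMoment_sub_one_pow, integral_const_mul]
  congr 1
  rw [integral_finsetSum _ fun t _ => integrable_finsetSum _ fun p _ =>
    integrable_prod_character hmeas _]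
  refine Finset.sum_congr rfl fun t _ => ?_
  rw [integral_finsetSum _ fun p _ => integrable_prod_character hmeas _]
  simp only [integral_prod_character hmeas hindep hmean]
  rw [Finset.sum_boole, Finset.filter_filter]
  simp only [balancedLoops, IsBalanced]

theorem re_integral_trace_characterMoment_sub_one_pow_le [IsProbabilityMeasure P]
    {Γ : Finset V} (hΓ : Γ.Nonempty)
    (hmeas : ∀ t v, AEStronglyMeasurable (fun ω => (χ t ω v : ℂ)) P)
    (hindep : iIndepFun (fun t ω v => (χ t ω v : ℂ)) P)
    (hmean : ∀ t v, v ≠ 0 → ∫ ω, (χ t ω v : ℂ) ∂P = 0) (M : ℕ) [NeZero M] :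
    (∫ ω, ((characterMoment Γ (χ · ω) - 1) ^ M).trace ∂P).re ≤
      Γ.card * stirlingG M (Fintype.card τ / Γ.card) := by
  classical
  have hcount : (∑ t : Fin M → τ, (balancedLoops Γ t).card : ℝ) ≤ ∑ k ∈ Finset.Icc 1 (M / 2),
      assocStirling M k * ((Fintype.card τ : ℝ) ^ k * (Γ.card : ℝ) ^ (M + 1 - k)) := by
    exact_mod_cast sum_card_balancedLoops_le Γ
  calc (∫ ω, ((characterMoment Γ (χ · ω) - 1) ^ M).trace ∂P).re
      = (Fintype.card τ : ℝ)⁻¹ ^ M * ∑ t : Fin M → τ, ((balancedLoops Γ t).card : ℝ) := by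
        rw [integral_trace_characterMoment_sub_one_pow Γ hmeas hindep hmean]
        simp only [← Complex.ofReal_natCast, ← Complex.ofReal_inv, ← Complex.ofReal_pow,
          ← Complex.ofReal_sum, ← Complex.ofReal_mul, Complex.ofReal_re]
    _ ≤ (Fintype.card τ : ℝ)⁻¹ ^ M * ∑ k ∈ Finset.Icc 1 (M / 2),
          assocStirling M k * ((Fintype.card τ : ℝ) ^ k * (Γ.card : ℝ) ^ (M + 1 - k)) := by
        gcongr
    _ = Γ.card * stirlingG M (Fintype.card τ / Γ.card) :=
        (mul_stirlingG_div M _ (Nat.cast_ne_zero.2 hΓ.card_ne_zero)).symm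

end RandomCharacters

section LatticeCharacters

open MeasureTheory

variable {ι : Type*} [Fintype ι]

/-- The character `k ↦ e^{2πi k·y}` of the lattice `ℤ^ι`. -/
noncomputable def latticeChar (y : ι → ℝ) : AddChar (ι → ℤ) Circle :=
  Real.fourierChar.compAddMonoidHom <|
    AddMonoidHom.mk' (fun k => ∑ i, k i * y i) fun k l => by
      simp only [Pi.add_apply, Int.cast_add, add_mul, Finset.sum_add_distrib]

theorem coe_latticeChar (y : ι → ℝ) (k : ι → ℤ) :
    (latticeChar y k : ℂ) = Complex.exp (2 * Real.pi * Complex.I * ∑ i, (k i : ℂ) * (y i : ℂ)) := by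
  refine (Real.fourierChar_apply _).trans (congrArg Complex.exp ?_)
  simp only [AddMonoidHom.mk'_apply]
  push_cast
  ring

theorem characterMoment_latticeChar {d n : ℕ} (Γ : Finset (Fin d → ℤ)) (x : Fin n → Fin d → ℝ) :
    characterMoment Γ (fun t => latticeChar (x t)) = sampleMoment Γ x := by
  simp only [characterMoment, characterMatrix, coe_latticeChar, Fintype.card_fin, sampleMoment,
    fourierMatrix]

theorem continuous_coe_latticeChar (k : ι → ℤ) :
    Continuous fun y : ι → ℝ => (latticeChar y k : ℂ) := by
  simp only [coe_latticeChar]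
  fun_prop

theorem integral_Icc_exp_two_pi_I_mul {k : ℤ} (hk : k ≠ 0) :
    ∫ y in Set.Icc (0 : ℝ) 1, Complex.exp (2 * Real.pi * Complex.I * k * y) = 0 := by
  have hc : (2 * Real.pi * Complex.I * k : ℂ) ≠ 0 :=
    mul_ne_zero Complex.two_pi_I_ne_zero (Int.cast_ne_zero.2 hk)
  have hperiod : Complex.exp (2 * Real.pi * Complex.I * k * (1 : ℝ)) = 1 :=
    Complex.exp_eq_one_iff.2 ⟨k, by push_cast; ring⟩
  rw [integral_Icc_eq_integral_Ioc, ← intervalIntegral.integral_of_le zero_le_one,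
    integral_exp_mul_complex hc, hperiod]
  simp

theorem integral_Icc_latticeChar {k : ι → ℤ} (hk : k ≠ 0) :
    ∫ y in Set.Icc (0 : ι → ℝ) 1, (latticeChar y k : ℂ) = 0 := by
  have hprod (y : ι → ℝ) :
      (latticeChar y k : ℂ) = ∏ i, Complex.exp (2 * Real.pi * Complex.I * k i * y i) := by
    rw [coe_latticeChar, Finset.mul_sum, Complex.exp_sum]
    simp only [mul_assoc]
  obtain ⟨i, hi⟩ := Function.ne_iff.1 hk
  simp only [hprod]
  rw [← Set.pi_univ_Icc, volume_pi, Measure.restrict_pi_pi,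
    integral_fintype_prod_eq_prod fun i (u : ℝ) => Complex.exp (2 * Real.pi * Complex.I * k i * u)]
  exact Finset.prod_eq_zero (Finset.mem_univ i) (integral_Icc_exp_two_pi_I_mul hi)

variable {Ω : Type*} [MeasurableSpace Ω] {P : Measure Ω} {X : Ω → ι → ℝ}

theorem map_eq_restrict_Icc_of_isUniform (hX : pdf.IsUniform X (Set.Icc 0 1) P) :
    P.map X = volume.restrict (Set.Icc 0 1) := by
  rw [hX, ProbabilityTheory.cond, Real.volume_Icc_pi]
  simp

theorem integral_latticeChar_of_isUniform (hX : pdf.IsUniform X (Set.Icc 0 1) P) {k : ι → ℤ}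
    (hk : k ≠ 0) : ∫ ω, (latticeChar (X ω) k : ℂ) ∂P = 0 := by
  have hvol : volume (Set.Icc (0 : ι → ℝ) 1) = 1 := by simp [Real.volume_Icc_pi]
  have hXm : AEMeasurable X P := hX.aemeasurable (by simp [hvol]) (by simp [hvol])
  rw [← integral_Icc_latticeChar hk, ← map_eq_restrict_Icc_of_isUniform hX,
    integral_map hXm (continuous_coe_latticeChar k).aestronglyMeasurable]

end LatticeCharacters

theorem mainTheorem2_general {V τ Ω : Type*} [AddCommGroup V] [DecidableEq V] [Fintype τ]
    [Nonempty τ] [MeasurableSpace Ω] (P : MeasureTheory.Measure Ω)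
    [MeasureTheory.IsProbabilityMeasure P] (Γ : Finset V) [Nonempty Γ]
    (χ : τ → Ω → AddChar V Circle)
    (hχ_meas : ∀ t v, MeasureTheory.AEStronglyMeasurable (fun ω => (χ t ω v : ℂ)) P)
    (hχ_indep : ProbabilityTheory.iIndepFun (fun t ω v => (χ t ω v : ℂ)) P)
    (hχ_mean : ∀ t v, v ≠ 0 → ∫ ω, (χ t ω v : ℂ) ∂P = 0)
    (ε : ℝ) (hε : 0 < ε) (m : ℕ) (hm : 1 ≤ m) :
    1 - ε ^ (-(2 * m : ℤ)) * (Γ.card : ℝ) * stirlingG (2 * m) (Fintype.card τ / Γ.card) ≤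
      P.real {ω |
        ‖characterMoment Γ (χ · ω) - 1‖ < ε ∧
        1 - ε < lambdaMin (characterMoment_isHermitian Γ (χ · ω)) ∧
        lambdaMin (characterMoment_isHermitian Γ (χ · ω)) ≤
          lambdaMax (characterMoment_isHermitian Γ (χ · ω)) ∧
        lambdaMax (characterMoment_isHermitian Γ (χ · ω)) < 1 + ε} := by
  have : NeZero (2 * m) := ⟨by lia⟩
  have hmoment := re_integral_trace_characterMoment_sub_one_pow_le
    (Finset.nonempty_coe_sort.1 ‹Nonempty Γ›) hχ_meas hχ_indep hχ_mean (2 * m)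
  calc 1 - ε ^ (-(2 * m : ℤ)) * (Γ.card : ℝ) * stirlingG (2 * m) (Fintype.card τ / Γ.card)
      ≤ 1 - ε ^ (-(2 * m : ℤ)) *
          (∫ ω, ((characterMoment Γ (χ · ω) - 1) ^ (2 * m)).trace ∂P).re := by
        rw [mul_assoc]
        gcongr
    _ ≤ P.real {ω | ‖characterMoment Γ (χ · ω) - 1‖ < ε} :=
        one_sub_trace_moment_le_measureReal_norm_lt
          (fun ω => (characterMoment_isHermitian Γ (χ · ω)).sub Matrix.isHermitian_one)
          (integrable_trace_characterMoment_sub_one_pow Γ hχ_meas (2 * m)) hε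
    _ ≤ _ := MeasureTheory.measureReal_mono fun ω hω => by
        have hω' : ‖characterMoment Γ (χ · ω) - algebraMap ℝ _ 1‖ < ε := by rwa [map_one]
        exact ⟨hω, sub_lt_lambdaMin _ hω', lambdaMin_le_lambdaMax _, lambdaMax_lt_add _ hω'⟩

theorem mainTheorem2 {Ω : Type*} [MeasurableSpace Ω]
    (P : MeasureTheory.Measure Ω) [MeasureTheory.IsProbabilityMeasure P]
    (d n : ℕ) (hn : 1 ≤ n) (Γ : Finset (Fin d → ℤ)) [Nonempty Γ] (D : ℕ) (hD : Γ.card = D)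
    (x : Fin n → Ω → (Fin d → ℝ)) (hx_meas : ∀ t, Measurable (x t))
    (hx_indep : ProbabilityTheory.iIndepFun x P)
    (hx_unif : ∀ t, MeasureTheory.pdf.IsUniform (x t) (Set.Icc 0 1) P)
    (ε : ℝ) (hε : 0 < ε) (m : ℕ) (hm : 1 ≤ m) :
    1 - ε ^ (-(2 * m : ℤ)) * (D : ℝ) * stirlingG (2 * m) ((n : ℝ) / (D : ℝ)) ≤
      P.real {ω |
        ‖sampleMoment Γ (fun t => x t ω) - 1‖ < ε ∧
        1 - ε < lambdaMin (sampleMoment_isHermitian Γ (fun t => x t ω)) ∧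
        lambdaMin (sampleMoment_isHermitian Γ (fun t => x t ω)) ≤
          lambdaMax (sampleMoment_isHermitian Γ (fun t => x t ω)) ∧
        lambdaMax (sampleMoment_isHermitian Γ (fun t => x t ω)) < 1 + ε} := by
  subst hD
  have : Nonempty (Fin n) := ⟨⟨0, hn⟩⟩
  simpa only [characterMoment_latticeChar, Fintype.card_fin] using
    mainTheorem2_general P Γ (fun t ω => latticeChar (x t ω))
      (fun t k => ((continuous_coe_latticeChar k).measurable.comp (hx_meas t)).aestronglyMeasurable)
      (hx_indep.comp (fun _ y k => (latticeChar y k : ℂ)) fun _ =>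
        measurable_pi_lambda _ fun k => (continuous_coe_latticeChar k).measurable)
      (fun t _ hk => integral_latticeChar_of_isUniform (hx_unif t) hk)
      ε hε m hm
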